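/- Work over $\mathbb C$, with the classical topology on projective spaces. Let $X\subset\mathbb P^3$ be a smooth irreducible closed algebraic curve that is not contained in a plane. For points $O_1,O_2\in\mathbb P^3$ let $\pi_i:\mathbb P^3\setminus\{O_i\}\to\mathbb P^2$ be a projection with centre $O_i$, given by a $3\times4$ matrix $M_i$ of rank $3$ with $M_iO_i=0$. Let $Y_i=\pi_i(X)$, and let $\phi_i$ be an irreducible homogeneous equation of the dual curve $Y_i^*$ (the set of lines tangent to $Y_i$). Let $$V\subset\mathbb P^2\times\mathbb P^8\times\mathbb P^2$$ be the set of triples $(e_1,F,e_2)$, with $F$ a nonzero $3\times3$ matrix up to scale, such that $Fe_1=0$, $e_2^TF=0$, and for some scalar $\lambda\neq0$ $$\phi_2(Fp)=\lambda\,\phi_1(e_1\times p)\qquad\text{for all }p\in\mathbb C^3 .$$ For $e\in\mathbb P^2$, a tangency point of $Y_i$ for $e$ is a point $q\in Y_i$ at which some line through $e$ is tangent to $Y_i$. (A line $l$ is tangent to $Y_i$ at $q$ if $(q,l)$ lies in the conormal variety of $Y_i$, the closure of the set of pairs formed by a smooth point and the tangent line there; $Y_i^*$ is the set of these $l$.)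 Two projections with matrices $N_1,N_2$ and centres $C_1,C_2$ realize $(e_1,F,e_2)$ if $F$ is their fundamental matrix (the matrix that sends a point $p$ of the first plane to the line which is the image, under the second projection, of the preimage of $p$ under the first), $e_1$ is the image of $C_2$ under $N_1$, and $e_2$ is the image of $C_1$ under $N_2$. Such a pair, when it exists, is unique up to a projective transformation of $\mathbb P^3$ and rescaling of the matrices. Given such a pair, let $L$ be the baseline, the line joining $C_1$ and $C_2$, and let $\{Q_\alpha\}$ be the set of all points of $\mathbb P^3$ that $N_1$ sends to a tangency point of $Y_1$ for $e_1$ and $N_2$ sends to a tangency point of $Y_2$ for $e_2$. A quadric surface is the zero set of a nonzero quadratic form on $\mathbb C^4$; it may be singular or reducible. **Proposition.** There is a nonempty Zariski-open subset of $\mathbb P^3\times\mathbb P^3$, depending only on $X$, such that for all $(O_1,O_2)$ in it and all projections $\pi_1,\pi_2$ with these centres the following holds. If every point $(e_1,F,e_2)\in V$ is realized by a pair of projections for which $L\cup\{Q_\alpha\}$ is not contained in any quadric surface, then $V$ is discrete: each of its points is isolated, and, equivalently for such an algebraic set, $V$ is finite. -/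

import Mathlib

open scoped LinearAlgebra.Projectivization Matrix

noncomputable section

namespace TwoViews

/-- The complex projective plane. -/
abbrev P2 : Type := ℙ ℂ (Fin 3 → ℂ)

/-- Complex projective three-space. -/
abbrev P3 : Type := ℙ ℂ (Fin 4 → ℂ)

/-- The projective space of nonzero `3 × 3` matrices up to scale. -/
abbrev P8 : Type := ℙ ℂ (Matrix (Fin 3) (Fin 3) ℂ)

/-- The classical topology of a complex projective space: the quotient topology from the space of
nonzero vectors. -/
instance projectiveTopology (E : Type*) [AddCommGroup E] [Module ℂ E] [TopologicalSpace E] :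
    TopologicalSpace (ℙ ℂ E) :=
  TopologicalSpace.coinduced
    (fun v : { v : E // v ≠ 0 } => Projectivization.mk ℂ v.1 v.2) inferInstance

/-- The gradient of a polynomial at a point. -/
def gradient {ι : Type*} (f : MvPolynomial ι ℂ) (v : ι → ℂ) : ι → ℂ :=
  fun i => MvPolynomial.eval v (MvPolynomial.pderiv i f)

/-- The homogeneous ideal of a set of points of a projective space. -/
def idealOf {ι : Type*} (X : Set (ℙ ℂ (ι → ℂ))) : Ideal (MvPolynomial ι ℂ) :=
  MvPolynomial.vanishingIdeal ℂ { v : ι → ℂ | ∃ hv : v ≠ 0, Projectivization.mk ℂ v hv ∈ X }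

/-- `X` is a smooth irreducible closed algebraic curve in projective three-space. -/
structure IsSmoothIrreducibleCurve (X : Set P3) : Prop where
  closed : ∀ x : P3, (∀ g ∈ idealOf X, MvPolynomial.eval x.rep g = 0) → x ∈ X
  irreducible : (idealOf X).IsPrime
  -- the affine cone over a curve is a surface
  dim_eq_one : ringKrullDim (MvPolynomial (Fin 4) ℂ ⧸ idealOf X) = 2
  -- Jacobian criterion in codimension two
  smooth : ∀ x ∈ X, Module.finrank ℂ
    (Submodule.span ℂ { w : Fin 4 → ℂ | ∃ g ∈ idealOf X, w = gradient g x.rep }) = 2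

/-- All points of `X` lie in one plane. -/
def IsPlanar (X : Set P3) : Prop :=
  ∃ h : Fin 4 → ℂ, h ≠ 0 ∧ ∀ x ∈ X, h ⬝ᵥ x.rep = 0

/-- `M` is the matrix of a projection of three-space onto a plane with centre `O`. -/
def IsProjectionFrom (M : Matrix (Fin 3) (Fin 4) ℂ) (O : P3) : Prop :=
  M.rank = 3 ∧ M *ᵥ O.rep = 0

/-- The projection with matrix `M` is defined at `P` and sends it to `p`. -/
def ProjectsTo (M : Matrix (Fin 3) (Fin 4) ℂ) (P : P3) (p : P2) : Prop :=
  ∃ c : ℂ, c ≠ 0 ∧ M *ᵥ P.rep = c • p.rep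

/-- The image of a set of points under the projection with matrix `M`. -/
def projected (M : Matrix (Fin 3) (Fin 4) ℂ) (X : Set P3) : Set P2 :=
  { p | ∃ P ∈ X, ProjectsTo M P p }

/-- `f` is an irreducible homogeneous equation of the plane curve `Y`. -/
def IsEquationOf (f : MvPolynomial (Fin 3) ℂ) (Y : Set P2) : Prop :=
  Irreducible f ∧ (∃ n : ℕ, f.IsHomogeneous n) ∧
    ∀ p : P2, p ∈ Y ↔ MvPolynomial.eval p.rep f = 0

/-- The line with coordinate vector `l` is tangent to the plane curve `f = 0` at `q`: the pair
`(q, l)` lies in the conormal variety of the curve, the Zariski closure in `P2 × P2` of the pairs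
(smooth point, tangent line there). At a node these are the tangents to the two branches.
The pairs of vectors below are closed under separate rescaling, so the polynomials that vanish on
them form the bihomogeneous ideal of the set of pairs. -/
def IsTangentAt (f : MvPolynomial (Fin 3) ℂ) (q l : P2) : Prop :=
  ∀ g : MvPolynomial (Fin 3 ⊕ Fin 3) ℂ,
    (∀ u w : Fin 3 → ℂ, u ≠ 0 → w ≠ 0 → MvPolynomial.eval u f = 0 →
      (∃ c : ℂ, w = c • gradient f u) → MvPolynomial.eval (Sum.elim u w) g = 0) →
    MvPolynomial.eval (Sum.elim q.rep l.rep) g = 0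

/-- The dual curve: the set of all tangent lines. -/
def dualCurve (f : MvPolynomial (Fin 3) ℂ) : Set P2 :=
  { l | ∃ q : P2, IsTangentAt f q l }

/-- The points at which a line through `e` is tangent to the curve `f = 0`. -/
def tangencyPoints (f : MvPolynomial (Fin 3) ℂ) (e : P2) : Set P2 :=
  { q | ∃ l : P2, IsTangentAt f q l ∧ l.rep ⬝ᵥ e.rep = 0 }

/-- The generalized Kruppa equation: `φ₂(F p) = lam φ₁(e₁ × p)` for all `p`, with `lam ≠ 0`. -/
def KruppaEquation (φ₁ φ₂ : MvPolynomial (Fin 3) ℂ) (e₁ : P2) (F : P8) : Prop :=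
  ∃ lam : ℂ, lam ≠ 0 ∧ ∀ p : Fin 3 → ℂ,
    MvPolynomial.eval (F.rep *ᵥ p) φ₂ = lam * MvPolynomial.eval (e₁.rep ⨯₃ p) φ₁

/-- The variety of triples `(e₁, F, e₂)` with the generalized Kruppa equation, `F e₁ = 0` and
`e₂ᵀ F = 0`. -/
def kruppaVariety (φ₁ φ₂ : MvPolynomial (Fin 3) ℂ) : Set (P2 × P8 × P2) :=
  { T | KruppaEquation φ₁ φ₂ T.1 T.2.1 ∧ T.2.1.rep *ᵥ T.1.rep = 0 ∧
    T.2.2.rep ᵥ* T.2.1.rep = 0 }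

/-- The fundamental matrix of two projections. The preimage of the `j`-th coordinate point of the
first plane is the meet of the planes given by rows `j + 1`, `j + 2` of `M₁` (indices mod 3), and
likewise for `M₂`; the entry at `(i, j)` is the incidence pairing of two such lines. So `F p` is the
image under the second projection of the preimage line of `p` under the first. -/
def fundamentalMatrix (M₁ M₂ : Matrix (Fin 3) (Fin 4) ℂ) : Matrix (Fin 3) (Fin 3) ℂ :=
  Matrix.of fun i j =>
    (Matrix.of ![M₂ (i + 1), M₂ (i + 2), M₁ (j + 1), M₁ (j + 2)]).det

/-- The pair of projections `N₁, N₂` has the epipolar geometry `(e₁, F, e₂)`: its fundamental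
matrix is `F`, the first epipole `e₁` is the image of the second centre, and the second epipole
`e₂` is the image of the first centre. -/
def Realizes (N₁ N₂ : Matrix (Fin 3) (Fin 4) ℂ) (T : P2 × P8 × P2) : Prop :=
  (∃ c : ℂ, c ≠ 0 ∧ fundamentalMatrix N₁ N₂ = c • T.2.1.rep) ∧
  ∃ C₁ C₂ : P3, IsProjectionFrom N₁ C₁ ∧ IsProjectionFrom N₂ C₂ ∧
    ProjectsTo N₁ C₂ T.1 ∧ ProjectsTo N₂ C₁ T.2.2

/-- The line that joins the centres of two projections. -/
def baseline (N₁ N₂ : Matrix (Fin 3) (Fin 4) ℂ) : Set P3 :=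
  { P | P.rep ∈ LinearMap.ker N₁.mulVecLin ⊔ LinearMap.ker N₂.mulVecLin }

/-- The points of three-space that project to a tangency point of an epipolar line in both
planes. -/
def spaceTangencyPoints (f₁ f₂ : MvPolynomial (Fin 3) ℂ) (N₁ N₂ : Matrix (Fin 3) (Fin 4) ℂ)
    (e₁ e₂ : P2) : Set P3 :=
  { Q | (∃ q₁ ∈ tangencyPoints f₁ e₁, ProjectsTo N₁ Q q₁) ∧
    ∃ q₂ ∈ tangencyPoints f₂ e₂, ProjectsTo N₂ Q q₂ }

/-- The set `S` lies on some quadric surface, possibly singular or reducible. -/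
def LiesOnQuadric (S : Set P3) : Prop :=
  ∃ B : QuadraticForm ℂ (Fin 4 → ℂ), B ≠ 0 ∧ ∀ P ∈ S, B P.rep = 0

/-- `R O₁ O₂` holds for a generic pair of points: for all pairs in the nonempty Zariski-open subset
of `P3 × P3` where some nonzero polynomial in the two coordinate vectors is not identically zero on
the representatives. -/
def ForGenericCentres (R : P3 → P3 → Prop) : Prop :=
  ∃ G : MvPolynomial (Fin 4 ⊕ Fin 4) ℂ, G ≠ 0 ∧
    ∀ (u v : Fin 4 → ℂ) (hu : u ≠ 0) (hv : v ≠ 0), MvPolynomial.eval (Sum.elim u v) G ≠ 0 →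
      R (Projectivization.mk ℂ u hu) (Projectivization.mk ℂ v hv)

end TwoViews

end

/-! Along a varying family of epipolar geometries, differentiating the epipolar constraint gives a
quadric through the baseline and the space tangency points. Take corresponding tangency points with
`q₂ᵀ F q₁ = 0`. The vectors `q₂ᵀ F` and `F q₁` are multiples of the tangent lines there, and a point
of a plane curve moves along its tangent, so the variations of `q₁` and `q₂` contribute nothing
(`dotProduct_derivation_eq_zero`). What remains is `q₂ᵀ (DF) q₁ = 0`: the form `x ↦ (N₂ x)ᵀ (DF) (N₁
x)` vanishes at these points, and on the baseline by differentiating `e₂ᵀ F e₁ = 0`. The form is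
nonzero unless `DF` is a multiple of `F`, because the projections determine `F` up to scale. The
matrices `N₁, N₂` are never differentiated.

No curve of geometries has to be constructed. An infinite set contains an injective sequence, which
has a limit over an ultrapower `K` of `ℂ`. If the normalized limit of `F` had only complex entries,
infinitely many terms would coincide. Hence some entry is transcendental and is moved by a
derivation of `K` over `ℂ` (`exists_derivation_ne_zero`). The form over `K` is represented by a
sequence of complex forms, almost all nonzero. None of their quadrics contains its whole
configuration, so there are points of the configurations where the forms do not vanish; the limit of
these points contradicts the vanishing over `K` (`finite_of_not_liesOnQuadric`). -/

namespace TwoViews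

/-! ### Derivations of fields in characteristic zero -/

section Derivations

/-- The kernel of `π` squares to zero, so formal smoothness lifts the identity of `K`. With dual
numbers as `B` this extends derivations from `P` to `K`. -/
theorem exists_ringHom_lift {P K B : Type*} [CommRing P] [Field K] [Algebra P K]
    [Algebra.FormallySmooth P K] [CommRing B] (φ : P →+* B) (π : B →+* K)
    (hπ : Function.Surjective π) (hsq : ∀ r s, π r = 0 → π s = 0 → r * s = 0)
    (hφ : ∀ p, π (φ p) = algebraMap P K p) :
    ∃ g : K →+* B, (∀ p, g (algebraMap P K p) = φ p) ∧ ∀ x, π (g x) = x := by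
  let : Algebra P B := φ.toAlgebra
  let π' : B →ₐ[P] K := { π with commutes' := hφ }
  have hker : IsNilpotent (RingHom.ker π) := by
    refine ⟨2, ?_⟩
    rw [pow_two, Ideal.zero_eq_bot, eq_bot_iff, Ideal.mul_le]
    exact fun r hr s hs => hsq r s hr hs
  let g := Algebra.FormallySmooth.liftOfSurjective (AlgHom.id P K) π' hπ hker
  exact ⟨g, fun p => g.commutes p,
    fun x => Algebra.FormallySmooth.liftOfSurjective_apply (AlgHom.id P K) π' hπ hker x⟩

/-- The extension splits into a localization, a purely transcendental extension and an algebraic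
one, which is separable in characteristic zero. -/
theorem formallySmooth_polynomial {k K : Type*} [Field k] [CharZero k] [Field K]
    [Algebra (Polynomial k) K] (h : Function.Injective (algebraMap (Polynomial k) K)) :
    Algebra.FormallySmooth (Polynomial k) K := by
  have : FaithfulSMul (Polynomial k) K := (faithfulSMul_iff_algebraMap_injective _ _).2 h
  let := FractionRing.liftAlgebra (Polynomial k) K
  have : Algebra.FormallySmooth (Polynomial k) (FractionRing (Polynomial k)) :=
    .of_isLocalization (nonZeroDivisors _)
  have : CharZero (FractionRing (Polynomial k)) :=
    charZero_of_injective_algebraMap (IsFractionRing.injective (Polynomial k) _)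
  obtain ⟨ι, v, hv⟩ := exists_isTranscendenceBasis' (FractionRing (Polynomial k)) K
  have := hv.isAlgebraic_field
  have : Algebra.FormallySmooth (FractionRing (Polynomial k)) K :=
    .of_algebraicIndependent_of_isSeparable hv.1
  exact .comp _ (FractionRing (Polynomial k)) _

/-- In characteristic zero a transcendental element is moved by some derivation. -/
theorem exists_derivation_ne_zero {k K : Type*} [Field k] [CharZero k] [Field K] [Algebra k K]
    {t : K} (ht : Transcendental k t) : ∃ D : Derivation k K K, D t ≠ 0 := by
  let : Algebra (Polynomial k) K := (Polynomial.aeval t).toAlgebra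
  have halg : ∀ p, algebraMap (Polynomial k) K p = Polynomial.aeval t p := fun _ => rfl
  have := formallySmooth_polynomial (k := k) (K := K)
    (transcendental_iff_injective.1 ht)
  -- The map `t ↦ t + ε` encodes `d/dt`; the `ε`-part of its lift to `K` is the derivation sought,
  -- with value `1` at `t`.
  let φ : Polynomial k →ₐ[k] TrivSqZeroExt K K :=
    Polynomial.aeval (TrivSqZeroExt.inl t + TrivSqZeroExt.inr 1)
  let π : TrivSqZeroExt K K →ₐ[k] K := TrivSqZeroExt.fstHom k K K
  have hφ : ∀ p, π (φ p) = algebraMap (Polynomial k) K p := by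
    intro p
    rw [halg, ← AlgHom.comp_apply]
    congr 1
    ext
    simp [φ, π]
  have hsq : ∀ r s, π r = 0 → π s = 0 → r * s = 0 := by
    intro r s hr hs
    have hr' : r.fst = 0 := hr
    have hs' : s.fst = 0 := hs
    ext <;> simp [hr', hs']
  obtain ⟨g, hg, hgπ⟩ := exists_ringHom_lift φ.toRingHom π.toRingHom
    (fun x => ⟨TrivSqZeroExt.inl x, rfl⟩) hsq hφ
  have hfst : ∀ x, (g x).fst = x := hgπ
  have hk : ∀ c : k, g (algebraMap k K c) = algebraMap k _ c := fun c => by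
    have := hg (Polynomial.C c)
    rw [halg, Polynomial.aeval_C] at this
    rw [this]
    exact φ.commutes c
  have hksnd : ∀ c : k, (g (algebraMap k K c)).snd = 0 := fun c => by
    rw [hk]; rfl
  refine ⟨Derivation.mk' { toFun := fun x => (g x).snd, map_add' := ?_, map_smul' := ?_ } ?_, ?_⟩
  · intro x y; simp
  · intro c x
    simp [Algebra.smul_def, hfst, hksnd]
  · intro x y
    simp [hfst, mul_comm]
  · have := hg Polynomial.X
    rw [halg, Polynomial.aeval_X] at this
    simp [this, φ]

theorem exists_algebraMap_eq_of_isAlgebraic {k K : Type*} [Field k] [IsAlgClosed k] [Field K]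
    [Algebra k K] {t : K} (ht : IsAlgebraic k t) : ∃ c : k, algebraMap k K c = t := by
  have := IntermediateField.isAlgebraic_adjoin_simple ht.isIntegral
  have hbot := IntermediateField.eq_bot_of_isAlgClosed_of_isAlgebraic
    (IntermediateField.adjoin k {t})
  exact IntermediateField.mem_bot.1 (hbot ▸ IntermediateField.mem_adjoin_simple_self k t)

theorem exists_algebraMap_eq_of_forall_derivation {k K : Type*} [Field k] [IsAlgClosed k]
    [CharZero k] [Field K] [Algebra k K] {t : K} (h : ∀ D : Derivation k K K, D t = 0) :
    ∃ c : k, algebraMap k K c = t := by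
  by_contra hc
  have : Transcendental k t := fun halg => hc (exists_algebraMap_eq_of_isAlgebraic halg)
  obtain ⟨D, hD⟩ := exists_derivation_ne_zero this
  exact hD (h D)

end Derivations

/-! ### Elimination of one variable -/

section Elimination

open Polynomial in
-- By Gauss's lemma `p` stays irreducible over the fraction field when its degree is positive, so
-- `p` and `g` are coprime there; clear denominators in a Bézout identity. In degree zero `p` itself
-- is the constant.
theorem exists_ne_zero_C_eq_of_irreducible {R : Type*} [CommRing R] [IsDomain R]
    [UniqueFactorizationMonoid R] {p g : R[X]} (hp : Irreducible p) (hg : ¬ p ∣ g) :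
    ∃ h : R, h ≠ 0 ∧ ∃ a b : R[X], C h = a * p + b * g := by
  classical
  let : NormalizedGCDMonoid R := Classical.arbitrary _
  let F := FractionRing R
  by_cases hd : p.natDegree = 0
  · obtain ⟨r, hr⟩ := natDegree_eq_zero.1 hd
    refine ⟨r, ?_, 1, 0, by simp [hr]⟩
    rintro rfl
    exact hp.ne_zero (by simp [← hr])
  have hprim : p.IsPrimitive := hp.isPrimitive hd
  have hcop : IsCoprime (p.map (algebraMap R F)) (g.map (algebraMap R F)) :=
    ((hprim.irreducible_iff_irreducible_map_fraction_map (K := F)).1 hp).coprime_iff_not_dvd.2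
      fun h => hg (hprim.dvd_of_fraction_map_dvd_fraction_map h)
  obtain ⟨a, b, hab⟩ := hcop
  obtain ⟨c, c0, hc⟩ := IsLocalization.integerNormalization_spec (nonZeroDivisors R) a
  obtain ⟨d, d0, hd⟩ := IsLocalization.integerNormalization_spec (nonZeroDivisors R) b
  rw [Algebra.smul_def, Polynomial.algebraMap_apply] at hc hd
  refine ⟨c * d, mul_ne_zero (nonZeroDivisors.ne_zero c0) (nonZeroDivisors.ne_zero d0),
    C d * IsLocalization.integerNormalization (nonZeroDivisors R) a,
    C c * IsLocalization.integerNormalization (nonZeroDivisors R) b, ?_⟩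
  apply map_injective (algebraMap R F) (IsFractionRing.injective _ _)
  simp only [Polynomial.map_mul, Polynomial.map_add, map_C, hc, hd, map_mul]
  linear_combination (- C (algebraMap R F c) * C (algebraMap R F d)) * hab

end Elimination

/-! ### Points of plane curves over an extension field and the contact form -/

section Legendre

open MvPolynomial

variable {K : Type*} [Field K] [Algebra ℂ K]

theorem aeval_smul_of_isHomogeneous {σ : Type*} {f : MvPolynomial σ ℂ} {n : ℕ}
    (hf : f.IsHomogeneous n) (x : K) (q : σ → K) : aeval (x • q) f = x ^ n * aeval q f := by
  rw [aeval_def, aeval_def, eval₂_eq, eval₂_eq, Finset.mul_sum]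
  refine Finset.sum_congr rfl fun d hd => ?_
  have hdeg : ∑ i ∈ d.support, d i = n := by
    rw [← hf (mem_support_iff.1 hd), Finsupp.weight_apply, Finsupp.sum]
    simp
  rw [← hdeg, ← Finset.prod_pow_eq_pow_sum]
  simp only [Pi.smul_apply, smul_eq_mul, mul_pow, Finset.prod_mul_distrib]
  ring

/-- A point of the plane with a coordinate that is not constant lies on at most one irreducible
curve with constant coefficients. -/
theorem aeval_ne_zero_of_not_dvd {f g : MvPolynomial (Fin 3) ℂ} (hf : Irreducible f)
    (hfg : ¬ f ∣ g) {m n : ℕ} (hm : f.IsHomogeneous m) (hn : g.IsHomogeneous n) {q : Fin 3 → K}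
    {i j : Fin 3} (hi : q i = 1) (hj : Transcendental ℂ (q j)) (h0 : aeval q f = 0) :
    aeval q g ≠ 0 := by
  intro h1
  have hij : i ≠ j := by
    rintro rfl
    exact hj (hi ▸ isAlgebraic_one)
  -- `finSuccEquiv` singles out variable `0`, so `σ` places the coordinate to be eliminated there
  -- and keeps `i` and `j`.
  obtain ⟨σ, hσi, hσj⟩ : ∃ σ : Equiv.Perm (Fin 3), σ 1 = i ∧ σ 2 = j := by
    have : ∀ i j : Fin 3, i ≠ j → ∃ σ : Equiv.Perm (Fin 3), σ 1 = i ∧ σ 2 = j := by decide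
    exact this i j hij
  let E := (renameEquiv ℂ σ.symm).trans (finSuccEquiv ℂ 2)
  have hEf : Irreducible (E f) := (MulEquiv.irreducible_iff E.toMulEquiv).2 hf
  have hEfg : ¬ E f ∣ E g := fun h => hfg ((map_dvd_iff E).1 h)
  obtain ⟨h, hne, a, b, hab⟩ := exists_ne_zero_C_eq_of_irreducible hEf hEfg
  -- The eliminant `h` need not be homogeneous, so it is evaluated at all complex multiples of `q`.
  have key : ∀ x : ℂ, aeval (fun l : Fin 2 => algebraMap ℂ K x * q (σ l.succ)) h = 0 := by
    intro x
    let ψ : Polynomial (MvPolynomial (Fin 2) ℂ) →+* K :=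
      Polynomial.eval₂RingHom
        (aeval (fun l : Fin 2 => algebraMap ℂ K x * q (σ l.succ)) :
          MvPolynomial (Fin 2) ℂ →ₐ[ℂ] K).toRingHom (algebraMap ℂ K x * q (σ 0))
    have hψ : ψ.comp E.toRingEquiv.toRingHom =
        (aeval (algebraMap ℂ K x • q) : MvPolynomial (Fin 3) ℂ →ₐ[ℂ] K).toRingHom := by
      apply MvPolynomial.ringHom_ext
      · intro c
        simp [ψ, E, finSuccEquiv_apply]
      · intro l
        obtain ⟨l, rfl⟩ := σ.surjective l
        refine Fin.cases ?_ (fun l => ?_) l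
        · simp [ψ, E, finSuccEquiv_apply, Algebra.smul_def]
        · simp [ψ, E, finSuccEquiv_apply, Algebra.smul_def]
    have hψ' : ∀ p, ψ (E p) = aeval (algebraMap ℂ K x • q) p := fun p => RingHom.congr_fun hψ p
    have h2 := congrArg ψ hab
    rw [map_add, map_mul, map_mul, hψ', hψ', aeval_smul_of_isHomogeneous hm,
      aeval_smul_of_isHomogeneous hn, h0, h1] at h2
    simpa [ψ] using h2
  have key2 : ∀ x y : ℂ, eval ![x, x * y] h = 0 := by
    intro x y
    let P : Polynomial ℂ := aeval ![Polynomial.C x, Polynomial.C x * Polynomial.X] h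
    have hP : Polynomial.aeval (q j) P = 0 := by
      rw [← key x]
      simp only [P]
      rw [← AlgHom.comp_apply, comp_aeval]
      congr 2
      funext l
      fin_cases l
      · simp [hi, hσi]
      · simp [hσj]
    have hP0 : P = 0 := by
      by_contra hP0
      exact hj ⟨P, hP0, hP⟩
    have := congrArg (Polynomial.aeval y) hP0
    simp only [P] at this
    rw [← AlgHom.comp_apply, comp_aeval, map_zero] at this
    rw [← this, ← MvPolynomial.aeval_eq_eval]
    congr 2
    funext l
    fin_cases l <;> simp
  have : X 0 * h = 0 := by
    refine MvPolynomial.funext fun v => ?_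
    rw [map_mul, eval_X, map_zero]
    by_cases hv : v 0 = 0
    · rw [hv, zero_mul]
    · have := key2 (v 0) (v 1 / v 0)
      rw [mul_div_cancel₀ _ hv] at this
      have hv' : v = ![v 0, v 1] := by
        funext l; fin_cases l <;> rfl
      rw [hv', this, mul_zero]
  exact hne ((mul_eq_zero.1 this).resolve_left (X_ne_zero 0))

theorem exists_pderiv_ne_zero {f : MvPolynomial (Fin 3) ℂ} (hf : Irreducible f) {n : ℕ}
    (hn : f.IsHomogeneous n) : n ≠ 0 ∧ ∃ m, pderiv m f ≠ 0 := by
  have h0 : n ≠ 0 := by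
    rintro rfl
    rw [← totalDegree_zero_iff_isHomogeneous, totalDegree_eq_zero_iff_eq_C] at hn
    apply hf.not_isUnit
    rw [hn]
    refine (IsUnit.mk0 _ ?_).map C
    intro hc
    rw [hc, map_zero] at hn
    exact hf.ne_zero hn
  refine ⟨h0, ?_⟩
  by_contra! h
  have := hn.sum_X_mul_pderiv
  simp only [h, mul_zero, Finset.sum_const_zero] at this
  exact (smul_ne_zero h0 hf.ne_zero) this.symm

/-- A non-constant point of an irreducible plane curve is smooth. -/
theorem exists_aeval_pderiv_ne_zero {f : MvPolynomial (Fin 3) ℂ} (hf : Irreducible f) {n : ℕ}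
    (hn : f.IsHomogeneous n) {q : Fin 3 → K} {i j : Fin 3} (hi : q i = 1)
    (hj : Transcendental ℂ (q j)) (h0 : aeval q f = 0) : ∃ m, aeval q (pderiv m f) ≠ 0 := by
  obtain ⟨hn0, m, hm⟩ := exists_pderiv_ne_zero hf hn
  refine ⟨m, aeval_ne_zero_of_not_dvd hf ?_ hn hn.pderiv hi hj h0⟩
  rintro ⟨g, hg⟩
  have hg0 : g ≠ 0 := by
    rintro rfl
    exact hm (by rw [hg, mul_zero])
  have h1 := hn.pderiv.totalDegree hm
  rw [hg, totalDegree_mul_of_isDomain hf.ne_zero hg0, hn.totalDegree hf.ne_zero] at h1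
  omega

theorem derivation_aeval {σ : Type*} [Fintype σ] (D : Derivation ℂ K K) (q : σ → K)
    (f : MvPolynomial σ ℂ) : D (aeval q f) = ∑ m, aeval q (pderiv m f) * D (q m) := by
  classical
  induction f using MvPolynomial.induction_on with
  | C a => simp
  | add p r hp hr => simp only [map_add, hp, hr, add_mul, Finset.sum_add_distrib]
  | mul_X p i hp =>
    rw [map_mul, aeval_X, Derivation.leibniz, hp]
    simp only [pderiv_mul, pderiv_X, map_add, map_mul, aeval_X, add_mul, Finset.sum_add_distrib,
      smul_eq_mul, Finset.mul_sum]
    rw [add_comm]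
    congr 1
    · exact Finset.sum_congr rfl fun m _ => by ring
    · simp [Pi.single_apply, apply_ite]

/-- The contact form vanishes along the conormal variety: if the line `l` is tangent to the curve
at `q`, then `l` contains the velocity of `q`. -/
theorem dotProduct_derivation_eq_zero {f : MvPolynomial (Fin 3) ℂ} (hf : Irreducible f) {n : ℕ}
    (hn : f.IsHomogeneous n) {q l : Fin 3 → K} (hq : q ≠ 0) (h0 : aeval q f = 0)
    (hlq : l ⬝ᵥ q = 0)
    (hl : ∀ a b, l a * aeval q (pderiv b f) = l b * aeval q (pderiv a f))
    (D : Derivation ℂ K K) : (l ⬝ᵥ fun m => D (q m)) = 0 := by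
  obtain ⟨i, hi⟩ := Function.ne_iff.1 hq
  rw [Pi.zero_apply] at hi
  let p : Fin 3 → K := (q i)⁻¹ • q
  have hpi : p i = 1 := by simp [p, hi]
  have hqp : q = q i • p := by simp [p, smul_smul, hi]
  have hp0 : aeval p f = 0 := by rw [aeval_smul_of_isHomogeneous hn, h0, mul_zero]
  have hlp : l ⬝ᵥ p = 0 := by simp only [p, dotProduct_smul, hlq, smul_zero]
  suffices hp : (l ⬝ᵥ fun m => D (p m)) = 0 by
    have : (fun m => D (q m)) = q i • (fun m => D (p m)) + D (q i) • p := by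
      funext m
      conv_lhs => rw [hqp]
      simp [mul_comm]
    rw [this, dotProduct_add, dotProduct_smul, dotProduct_smul, hp, hlp]
    simp
  -- A singular point of the curve has constant normalized coordinates and falls under this case.
  -- Otherwise `p` is a smooth point and `l` is proportional to the gradient.
  by_cases hconst : ∀ m, D (p m) = 0
  · simp [hconst, dotProduct]
  push Not at hconst
  obtain ⟨j, hj⟩ := hconst
  have hjt : Transcendental ℂ (p j) := by
    intro halg
    obtain ⟨c, hc⟩ := exists_algebraMap_eq_of_isAlgebraic halg
    exact hj (by rw [← hc, D.map_algebraMap])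
  obtain ⟨m, hm⟩ := exists_aeval_pderiv_ne_zero hf hn hpi hjt hp0
  have hlp' : ∀ a b, l a * aeval p (pderiv b f) = l b * aeval p (pderiv a f) := by
    intro a b
    simp only [p, aeval_smul_of_isHomogeneous hn.pderiv]
    linear_combination ((q i)⁻¹ ^ (n - 1)) * hl a b
  have h1 := derivation_aeval D p f
  rw [hp0, map_zero] at h1
  refine (mul_eq_zero.1 (?_ : aeval p (pderiv m f) * (l ⬝ᵥ fun m => D (p m)) = 0)).resolve_left hm
  rw [dotProduct, Finset.mul_sum]
  calc _ = l m * ∑ a, aeval p (pderiv a f) * D (p a) := by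
        rw [Finset.mul_sum]
        refine Finset.sum_congr rfl fun a _ => ?_
        linear_combination D (p a) * hlp' a m
    _ = 0 := by rw [← h1, mul_zero]

end Legendre

/-! ### Alternating forms on a four-dimensional space -/

section LinearAlgebra

variable {K : Type*} [Field K]

theorem exists_eq_smul_of_cross_eq_zero {w n : Fin 3 → K} (hn : n ≠ 0) (h : n ⨯₃ w = 0) :
    ∃ c : K, w = c • n := by
  by_contra! hc
  refine (crossProduct_ne_zero_iff_linearIndependent.2 ?_) h
  rw [LinearIndependent.pair_iff' hn]
  exact fun a ha => hc a ha.symm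

theorem exists_eq_smul_of_orthogonal {u v w₁ w₂ : Fin 3 → K} (hu : u ≠ 0)
    (huv : ¬ ∃ c : K, v = c • u) (h₁u : w₁ ⬝ᵥ u = 0) (h₁v : w₁ ⬝ᵥ v = 0) (h₂u : w₂ ⬝ᵥ u = 0)
    (h₂v : w₂ ⬝ᵥ v = 0) (h₂ : w₂ ≠ 0) : ∃ c : K, w₁ = c • w₂ := by
  have hn : u ⨯₃ v ≠ 0 := fun h => huv (exists_eq_smul_of_cross_eq_zero hu h)
  have key : ∀ w : Fin 3 → K, w ⬝ᵥ u = 0 → w ⬝ᵥ v = 0 → ∃ c : K, w = c • (u ⨯₃ v) := by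
    intro w hwu hwv
    apply exists_eq_smul_of_cross_eq_zero hn
    simp only [dotProduct, Fin.sum_univ_three] at hwu hwv
    rw [cross_apply, cross_apply]
    ext i
    fin_cases i
    · simp
      linear_combination v 0 * hwu - u 0 * hwv
    · simp
      linear_combination v 1 * hwu - u 1 * hwv
    · simp
      linear_combination v 2 * hwu - u 2 * hwv
  obtain ⟨c₁, hc₁⟩ := key w₁ h₁u h₁v
  obtain ⟨c₂, hc₂⟩ := key w₂ h₂u h₂v
  have hc : c₂ ≠ 0 := by
    rintro rfl
    exact h₂ (by rw [hc₂, zero_smul])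
  exact ⟨c₁ / c₂, by rw [hc₂, smul_smul, div_mul_cancel₀ _ hc, hc₁]⟩

variable {V : Type*} [AddCommGroup V] [Module K V]

/-- A nonzero alternating form on a four-dimensional space with two independent vectors in its
radical: these vectors and two others that pair nontrivially span the space. -/
theorem exists_combination_of_isAlt (hV : Module.finrank K V = 4) {A : LinearMap.BilinForm K V}
    (hA : A.IsAlt) {c₁ c₂ u v : V} (h₁ : A c₁ = 0) (h₂ : A c₂ = 0)
    (hc : LinearIndependent K ![c₁, c₂]) (huv : A u v ≠ 0) (x : V) :
    ∃ a b s t : K, x = a • c₁ + b • c₂ + s • u + t • v := by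
  have hli : LinearIndependent K ![c₁, c₂, u, v] := by
    rw [Fintype.linearIndependent_iff]
    intro g hg
    simp only [Fin.sum_univ_four] at hg
    simp only [Matrix.cons_val] at hg
    have hvu : A v u ≠ 0 := by rw [← hA.neg_eq]; exact neg_ne_zero.2 huv
    have h3 : g 3 = 0 := by
      have := congrArg (fun z => A z u) hg
      simpa [h₁, h₂, hA.self_eq_zero, hvu] using this
    have h2 : g 2 = 0 := by
      have := congrArg (fun z => A z v) hg
      simpa [h₁, h₂, hA.self_eq_zero, huv] using this
    rw [h2, h3, zero_smul, zero_smul, add_zero, add_zero] at hg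
    obtain ⟨h0, h1⟩ := LinearIndependent.pair_iff.1 hc _ _ hg
    intro i
    fin_cases i <;> assumption
  have hb := (hli.span_eq_top_of_card_eq_finrank (by simp [hV]))
  have hx : x ∈ Submodule.span K (Set.range ![c₁, c₂, u, v]) := hb ▸ Submodule.mem_top
  obtain ⟨g, hg⟩ := (Submodule.mem_span_range_iff_exists_fun K).1 hx
  refine ⟨g 0, g 1, g 2, g 3, ?_⟩
  rw [← hg, Fin.sum_univ_four]
  simp

theorem exists_mem_radical_eq (hV : Module.finrank K V = 4) {A : LinearMap.BilinForm K V}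
    (hA : A.IsAlt) {c₁ c₂ : V} (h₁ : A c₁ = 0) (h₂ : A c₂ = 0)
    (hc : LinearIndependent K ![c₁, c₂]) (hA0 : A ≠ 0) {x : V} (hx : A x = 0) :
    ∃ a b : K, x = a • c₁ + b • c₂ := by
  obtain ⟨u, v, huv⟩ : ∃ u v, A u v ≠ 0 := by
    by_contra! h
    exact hA0 (LinearMap.ext₂ h)
  have hvu : A v u ≠ 0 := by rw [← hA.neg_eq]; exact neg_ne_zero.2 huv
  obtain ⟨a, b, s, t, rfl⟩ := exists_combination_of_isAlt hV hA h₁ h₂ hc huv x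
  have hs : s = 0 := by
    have := congrArg (fun z => z v) hx
    simpa [h₁, h₂, hA.self_eq_zero, huv] using this
  have ht : t = 0 := by
    have := congrArg (fun z => z u) hx
    simpa [h₁, h₂, hA.self_eq_zero, hvu] using this
  exact ⟨a, b, by simp [hs, ht]⟩

/-- Both forms descend to the two-dimensional quotient by `c₁, c₂`, where alternating forms make up
a line. -/
theorem exists_eq_smul_of_isAlt (hV : Module.finrank K V = 4) {A B : LinearMap.BilinForm K V}
    (hA : A.IsAlt) (hB : B.IsAlt) {c₁ c₂ : V} (h₁ : A c₁ = 0) (h₂ : A c₂ = 0)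
    (h₁' : B c₁ = 0) (h₂' : B c₂ = 0)
    (hc : LinearIndependent K ![c₁, c₂]) (hA0 : A ≠ 0) : ∃ r : K, B = r • A := by
  obtain ⟨u, v, huv⟩ : ∃ u v, A u v ≠ 0 := by
    by_contra! h
    exact hA0 (LinearMap.ext₂ h)
  have h₁r : ∀ x, A x c₁ = 0 := fun x => by rw [← hA.neg_eq, h₁]; simp
  have h₂r : ∀ x, A x c₂ = 0 := fun x => by rw [← hA.neg_eq, h₂]; simp
  have h₁r' : ∀ x, B x c₁ = 0 := fun x => by rw [← hB.neg_eq, h₁']; simp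
  have h₂r' : ∀ x, B x c₂ = 0 := fun x => by rw [← hB.neg_eq, h₂']; simp
  refine ⟨B u v / A u v, LinearMap.ext₂ fun x y => ?_⟩
  obtain ⟨a, b, s, t, rfl⟩ := exists_combination_of_isAlt hV hA h₁ h₂ hc huv x
  obtain ⟨a', b', s', t', rfl⟩ := exists_combination_of_isAlt hV hA h₁ h₂ hc huv y
  have hvu : A v u = - A u v := (hA.neg_eq _ _).symm
  have hvu' : B v u = - B u v := (hB.neg_eq _ _).symm
  simp [h₁, h₂, h₁', h₂', h₁r, h₂r, h₁r', h₂r', hA.self_eq_zero, hB.self_eq_zero, hvu, hvu']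
  field_simp

end LinearAlgebra

/-! ### The epipolar constraint -/

section Fundamental

/-- This is the linear relation among the five vectors `M 0, M 1, M 2, r, s` of four-space, with
their maximal minors as coefficients, paired with `x`. -/
theorem sum_det_cyclic (M : Matrix (Fin 3) (Fin 4) ℂ) (r s x : Fin 4 → ℂ) :
    ∑ i, (M *ᵥ x) i * (Matrix.of ![M (i + 1), M (i + 2), r, s]).det =
      (r ⬝ᵥ x) * (Matrix.of ![M 0, M 1, M 2, s]).det -
        (s ⬝ᵥ x) * (Matrix.of ![M 0, M 1, M 2, r]).det := by
  simp only [Fin.sum_univ_three, Matrix.mulVec, dotProduct, Fin.sum_univ_four,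
    Matrix.det_succ_row_zero, Matrix.det_fin_zero]
  simp [Fin.sum_univ_succ, Fin.succAbove, Matrix.submatrix]
  ring

/-- Both preimage lines pass through `x`. Algebraically, the cyclic relation leaves a triple product
in which the vector `M₁ *ᵥ x` is repeated. -/
theorem fundamentalMatrix_incidence (M₁ M₂ : Matrix (Fin 3) (Fin 4) ℂ) (x : Fin 4 → ℂ) :
    (M₂ *ᵥ x) ⬝ᵥ (fundamentalMatrix M₁ M₂ *ᵥ (M₁ *ᵥ x)) = 0 := by
  have h : (M₂ *ᵥ x) ⬝ᵥ (fundamentalMatrix M₁ M₂ *ᵥ (M₁ *ᵥ x)) =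
      ∑ j, (M₁ *ᵥ x) j * ∑ i, (M₂ *ᵥ x) i *
        (Matrix.of ![M₂ (i + 1), M₂ (i + 2), M₁ (j + 1), M₁ (j + 2)]).det := by
    generalize M₂ *ᵥ x = y
    generalize M₁ *ᵥ x = z
    simp only [Matrix.mulVec, dotProduct, fundamentalMatrix, Matrix.of_apply, Finset.mul_sum]
    rw [Finset.sum_comm]
    exact Finset.sum_congr rfl fun j _ => Finset.sum_congr rfl fun i _ => by ring
  rw [h]
  simp_rw [sum_det_cyclic]
  rw [Fin.sum_univ_three]
  have e : ∀ i, (M₁ *ᵥ x) i = M₁ i ⬝ᵥ x := fun i => rfl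
  simp only [e, show (1 : Fin 3) + 1 = 2 from rfl, show (1 : Fin 3) + 2 = 0 from rfl,
    show (2 : Fin 3) + 1 = 0 from rfl, show (2 : Fin 3) + 2 = 1 from rfl, zero_add]
  ring

theorem exists_right_inverse_of_rank {M : Matrix (Fin 3) (Fin 4) ℂ} (h : M.rank = 3) :
    ∃ R : Matrix (Fin 4) (Fin 3) ℂ, M * R = 1 := by
  rw [← Matrix.mulVec_surjective_iff_exists_right_inverse]
  have : LinearMap.range M.mulVecLin = ⊤ := by
    apply Submodule.eq_top_of_finrank_eq
    rw [← Matrix.rank, h]; simp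
  exact LinearMap.range_eq_top.1 this

end Fundamental

/-! ### Epipolar geometry over a field and its derivative -/

section Epipolar

variable {K : Type*} [Field K]

/-- The matrices `N₁, N₂` with right inverses `R₁, R₂` and centres `C₁, C₂` have the epipolar
geometry `(e₁, F, e₂)`. -/
structure IsEpipolar (N₁ N₂ : Matrix (Fin 3) (Fin 4) K) (R₁ R₂ : Matrix (Fin 4) (Fin 3) K)
    (C₁ C₂ : Fin 4 → K) (F : Matrix (Fin 3) (Fin 3) K) (e₁ e₂ : Fin 3 → K) : Prop where
  mul_right₁ : N₁ * R₁ = 1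
  mul_right₂ : N₂ * R₂ = 1
  centre₁ : N₁ *ᵥ C₁ = 0
  centre₂ : N₂ *ᵥ C₂ = 0
  epipole₁ : N₁ *ᵥ C₂ = e₁
  epipole₂ : N₂ *ᵥ C₁ = e₂
  ne_zero₁ : e₁ ≠ 0
  ne_zero₂ : e₂ ≠ 0
  ne_zero : F ≠ 0
  mulVec_eq_zero : F *ᵥ e₁ = 0
  vecMul_eq_zero : e₂ ᵥ* F = 0
  incidence : ∀ x, (N₂ *ᵥ x) ⬝ᵥ (F *ᵥ (N₁ *ᵥ x)) = 0

/-- The bilinear form `(x, y) ↦ (N₂ x)ᵀ G (N₁ y)`. -/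
def epipolarForm (N₁ N₂ : Matrix (Fin 3) (Fin 4) K) (G : Matrix (Fin 3) (Fin 3) K) :
    LinearMap.BilinForm K (Fin 4 → K) :=
  Matrix.toBilin' (N₂ᵀ * G * N₁)

theorem epipolarForm_apply (N₁ N₂ : Matrix (Fin 3) (Fin 4) K) (G : Matrix (Fin 3) (Fin 3) K)
    (x y : Fin 4 → K) :
    epipolarForm N₁ N₂ G x y = (N₂ *ᵥ x) ⬝ᵥ (G *ᵥ (N₁ *ᵥ y)) := by
  rw [epipolarForm, Matrix.toBilin'_apply', Matrix.dotProduct_mulVec, ← Matrix.vecMul_vecMul,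
    ← Matrix.vecMul_vecMul, Matrix.vecMul_transpose, ← Matrix.dotProduct_mulVec,
    ← Matrix.dotProduct_mulVec]

theorem epipolarForm_eq_zero₁ {N₁ N₂ : Matrix (Fin 3) (Fin 4) K} {G : Matrix (Fin 3) (Fin 3) K}
    (hG : (epipolarForm N₁ N₂ G).IsAlt) {x : Fin 4 → K} (hx : N₁ *ᵥ x = 0) :
    epipolarForm N₁ N₂ G x = 0 := by
  refine LinearMap.ext fun y => ?_
  rw [← hG.neg_eq, epipolarForm_apply, hx]
  simp

theorem epipolarForm_eq_zero₂ {N₁ N₂ : Matrix (Fin 3) (Fin 4) K} (G : Matrix (Fin 3) (Fin 3) K)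
    {x : Fin 4 → K} (hx : N₂ *ᵥ x = 0) : epipolarForm N₁ N₂ G x = 0 := by
  refine LinearMap.ext fun y => ?_
  rw [epipolarForm_apply, hx]
  simp

namespace IsEpipolar

variable {N₁ N₂ : Matrix (Fin 3) (Fin 4) K} {R₁ R₂ : Matrix (Fin 4) (Fin 3) K}
  {C₁ C₂ : Fin 4 → K} {F : Matrix (Fin 3) (Fin 3) K} {e₁ e₂ : Fin 3 → K}

theorem mulVec_mulVec₁ (h : IsEpipolar N₁ N₂ R₁ R₂ C₁ C₂ F e₁ e₂) (v : Fin 3 → K) :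
    N₁ *ᵥ (R₁ *ᵥ v) = v := by
  rw [Matrix.mulVec_mulVec, h.mul_right₁, Matrix.one_mulVec]

theorem mulVec_mulVec₂ (h : IsEpipolar N₁ N₂ R₁ R₂ C₁ C₂ F e₁ e₂) (v : Fin 3 → K) :
    N₂ *ᵥ (R₂ *ᵥ v) = v := by
  rw [Matrix.mulVec_mulVec, h.mul_right₂, Matrix.one_mulVec]

theorem linearIndependent (h : IsEpipolar N₁ N₂ R₁ R₂ C₁ C₂ F e₁ e₂) :
    LinearIndependent K ![C₁, C₂] := by
  rw [LinearIndependent.pair_iff' (by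
    rintro rfl
    exact h.ne_zero₂ (by rw [← h.epipole₂, Matrix.mulVec_zero]))]
  rintro a rfl
  exact h.ne_zero₁ (by rw [← h.epipole₁, Matrix.mulVec_smul, h.centre₁, smul_zero])

theorem isAlt (h : IsEpipolar N₁ N₂ R₁ R₂ C₁ C₂ F e₁ e₂) : (epipolarForm N₁ N₂ F).IsAlt :=
  fun x => by rw [epipolarForm_apply, h.incidence]

theorem eq_zero_of_epipolarForm (h : IsEpipolar N₁ N₂ R₁ R₂ C₁ C₂ F e₁ e₂)
    {G : Matrix (Fin 3) (Fin 3) K} (hG : epipolarForm N₁ N₂ G = 0) : G = 0 := by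
  ext i j
  have := congrArg (fun z => z (R₂ *ᵥ Pi.single i 1) (R₁ *ᵥ Pi.single j 1)) hG
  simp only [epipolarForm_apply, h.mulVec_mulVec₁, h.mulVec_mulVec₂] at this
  simpa using this

theorem epipolarForm_ne_zero (h : IsEpipolar N₁ N₂ R₁ R₂ C₁ C₂ F e₁ e₂) :
    epipolarForm N₁ N₂ F ≠ 0 :=
  fun h0 => h.ne_zero (h.eq_zero_of_epipolarForm h0)

theorem exists_eq_of_mem_radical (h : IsEpipolar N₁ N₂ R₁ R₂ C₁ C₂ F e₁ e₂) {x : Fin 4 → K}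
    (hx : epipolarForm N₁ N₂ F x = 0) : ∃ a b : K, x = a • C₁ + b • C₂ :=
  exists_mem_radical_eq (by simp) h.isAlt (epipolarForm_eq_zero₁ h.isAlt h.centre₁)
    (epipolarForm_eq_zero₂ F h.centre₂) h.linearIndependent h.epipolarForm_ne_zero hx

theorem exists_eq_smul_of_mulVec (h : IsEpipolar N₁ N₂ R₁ R₂ C₁ C₂ F e₁ e₂) {v : Fin 3 → K}
    (hv : F *ᵥ v = 0) : ∃ c : K, v = c • e₁ := by
  have hx : epipolarForm N₁ N₂ F (R₁ *ᵥ v) = 0 := by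
    refine LinearMap.ext fun y => ?_
    rw [← h.isAlt.neg_eq, epipolarForm_apply, h.mulVec_mulVec₁, hv]
    simp
  obtain ⟨a, b, hab⟩ := h.exists_eq_of_mem_radical hx
  refine ⟨b, ?_⟩
  rw [← h.mulVec_mulVec₁ v, hab, Matrix.mulVec_add, Matrix.mulVec_smul, Matrix.mulVec_smul,
    h.centre₁, h.epipole₁, smul_zero, zero_add]

theorem exists_eq_smul_of_vecMul (h : IsEpipolar N₁ N₂ R₁ R₂ C₁ C₂ F e₁ e₂) {v : Fin 3 → K}
    (hv : v ᵥ* F = 0) : ∃ c : K, v = c • e₂ := by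
  have hx : epipolarForm N₁ N₂ F (R₂ *ᵥ v) = 0 := by
    refine LinearMap.ext fun y => ?_
    rw [epipolarForm_apply, h.mulVec_mulVec₂, Matrix.dotProduct_mulVec, hv]
    simp
  obtain ⟨a, b, hab⟩ := h.exists_eq_of_mem_radical hx
  refine ⟨a, ?_⟩
  rw [← h.mulVec_mulVec₂ v, hab, Matrix.mulVec_add, Matrix.mulVec_smul, Matrix.mulVec_smul,
    h.centre₂, h.epipole₂, smul_zero, add_zero]

/-- The fundamental matrix is determined up to scale by the two projections. -/
theorem exists_eq_smul_of_incidence (h : IsEpipolar N₁ N₂ R₁ R₂ C₁ C₂ F e₁ e₂)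
    {G : Matrix (Fin 3) (Fin 3) K} (hG : ∀ x, (N₂ *ᵥ x) ⬝ᵥ (G *ᵥ (N₁ *ᵥ x)) = 0) :
    ∃ c : K, G = c • F := by
  have hGalt : (epipolarForm N₁ N₂ G).IsAlt := fun x => by rw [epipolarForm_apply, hG]
  obtain ⟨c, hc⟩ := exists_eq_smul_of_isAlt (by simp) h.isAlt hGalt (epipolarForm_eq_zero₁ h.isAlt h.centre₁)
    (epipolarForm_eq_zero₂ F h.centre₂) (epipolarForm_eq_zero₁ hGalt h.centre₁) (epipolarForm_eq_zero₂ G h.centre₂)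
    h.linearIndependent h.epipolarForm_ne_zero
  refine ⟨c, sub_eq_zero.1 (h.eq_zero_of_epipolarForm ?_)⟩
  refine LinearMap.ext₂ fun x y => ?_
  have := congrArg (fun z => z x y) hc
  simp only [LinearMap.smul_apply, epipolarForm_apply] at this
  rw [epipolarForm_apply, Matrix.sub_mulVec, dotProduct_sub, Matrix.smul_mulVec, dotProduct_smul,
    this, sub_self]
  rfl

theorem smul (h : IsEpipolar N₁ N₂ R₁ R₂ C₁ C₂ F e₁ e₂) {c : K} (hc : c ≠ 0) :
    IsEpipolar N₁ N₂ R₁ R₂ C₁ C₂ (c • F) e₁ e₂ where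
  __ := h
  ne_zero := smul_ne_zero hc h.ne_zero
  mulVec_eq_zero := by rw [Matrix.smul_mulVec, h.mulVec_eq_zero, smul_zero]
  vecMul_eq_zero := by rw [Matrix.vecMul_smul, h.vecMul_eq_zero, smul_zero]
  incidence x := by rw [Matrix.smul_mulVec, dotProduct_smul, h.incidence, smul_zero]

end IsEpipolar

theorem derivation_bilinear {k : Type*} [CommRing k] [Algebra k K] (D : Derivation k K K)
    (F : Matrix (Fin 3) (Fin 3) K) (u v : Fin 3 → K) :
    D (u ⬝ᵥ (F *ᵥ v)) = (fun i => D (u i)) ⬝ᵥ (F *ᵥ v) + u ⬝ᵥ (F.map D *ᵥ v) +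
      (u ᵥ* F) ⬝ᵥ (fun i => D (v i)) := by
  simp only [Matrix.mulVec, Matrix.vecMul, dotProduct, Fin.sum_univ_three, map_add,
    Derivation.leibniz, smul_eq_mul, Matrix.map_apply]
  ring

namespace IsEpipolar

variable {N₁ N₂ : Matrix (Fin 3) (Fin 4) K} {R₁ R₂ : Matrix (Fin 4) (Fin 3) K}
  {C₁ C₂ : Fin 4 → K} {F : Matrix (Fin 3) (Fin 3) K} {e₁ e₂ : Fin 3 → K}
  {k : Type*} [CommRing k] [Algebra k K]

/-- The quadratic form given by a derivative of a normalized fundamental matrix is nonzero. -/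
theorem exists_quadratic_ne_zero (h : IsEpipolar N₁ N₂ R₁ R₂ C₁ C₂ F e₁ e₂)
    (D : Derivation k K K) {i j : Fin 3} (hij : F i j = 1) {a b : Fin 3} (hab : D (F a b) ≠ 0) :
    ∃ x, (N₂ *ᵥ x) ⬝ᵥ (F.map D *ᵥ (N₁ *ᵥ x)) ≠ 0 := by
  by_contra! h0
  -- A vanishing quadratic form makes `DF` a multiple `c F`; at the entry normalized to `1` this
  -- reads `0 = c`.
  obtain ⟨c, hc⟩ := h.exists_eq_smul_of_incidence h0
  have h1 := congrFun (congrFun hc i) j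
  have h2 := congrFun (congrFun hc a) b
  simp only [Matrix.map_apply, Matrix.smul_apply, hij, Derivation.map_one_eq_zero, smul_eq_mul,
    mul_one] at h1 h2
  exact hab (by rw [h2, ← h1, zero_mul])

/-- On the baseline the value is `s t e₂ᵀ (DF) e₁`. It is zero by differentiating `e₂ᵀ F e₁ = 0`,
whose other two terms contain `F e₁` or `e₂ᵀ F`. -/
theorem quadratic_baseline (h : IsEpipolar N₁ N₂ R₁ R₂ C₁ C₂ F e₁ e₂)
    (D : Derivation k K K) (s t : K) :
    (N₂ *ᵥ (s • C₁ + t • C₂)) ⬝ᵥ (F.map D *ᵥ (N₁ *ᵥ (s • C₁ + t • C₂))) = 0 := by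
  have h0 := derivation_bilinear D F e₂ e₁
  rw [h.mulVec_eq_zero, h.vecMul_eq_zero, dotProduct_zero, dotProduct_zero, map_zero,
    zero_dotProduct, zero_add, add_zero] at h0
  simp only [Matrix.mulVec_add, Matrix.mulVec_smul, h.centre₁, h.centre₂, h.epipole₁, h.epipole₂,
    smul_zero, zero_add, add_zero, smul_dotProduct, dotProduct_smul, ← h0]

/-- Differentiate `q₂ᵀ F q₁ = 0`: the terms with `D q₁` and `D q₂` are contact forms and vanish. -/
theorem quadratic_tangency (h : IsEpipolar N₁ N₂ R₁ R₂ C₁ C₂ F e₁ e₂)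
    (D : Derivation k K K) {x : Fin 4 → K} {q₁ q₂ l₁ l₂ : Fin 3 → K} {c₁ c₂ d₁ d₂ : K}
    (hc₁ : c₁ ≠ 0) (hc₂ : c₂ ≠ 0) (hq₁ : N₁ *ᵥ x = c₁ • q₁) (hq₂ : N₂ *ᵥ x = c₂ • q₂)
    (hl₂ : F *ᵥ q₁ = d₂ • l₂) (hl₁ : q₂ ᵥ* F = d₁ • l₁)
    (hD₁ : (l₁ ⬝ᵥ fun i => D (q₁ i)) = 0) (hD₂ : (l₂ ⬝ᵥ fun i => D (q₂ i)) = 0) :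
    (N₂ *ᵥ x) ⬝ᵥ (F.map D *ᵥ (N₁ *ᵥ x)) = 0 := by
  have h0 := h.incidence x
  rw [hq₁, hq₂, Matrix.mulVec_smul, smul_dotProduct, dotProduct_smul] at h0
  have h1 := derivation_bilinear D F q₂ q₁
  rw [((smul_eq_zero.1 h0).resolve_left hc₂ |> smul_eq_zero.1).resolve_left hc₁, hl₁, hl₂,
    smul_dotProduct, dotProduct_smul, hD₁, dotProduct_comm _ l₂, hD₂, map_zero, smul_zero,
    smul_zero, zero_add, add_zero] at h1
  rw [hq₁, hq₂, Matrix.mulVec_smul, smul_dotProduct, dotProduct_smul, ← h1, smul_zero, smul_zero]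

end IsEpipolar

end Epipolar

/-! ### Tangency data of a realized triple -/

section Realization

/-- The point `q` and the line `l` satisfy the evident equations of the conormal variety of
`f = 0`. -/
structure IsConormal {K : Type*} [Field K] [Algebra ℂ K] (f : MvPolynomial (Fin 3) ℂ)
    (q l : Fin 3 → K) : Prop where
  eq_zero : MvPolynomial.aeval q f = 0
  incident : l ⬝ᵥ q = 0
  parallel : ∀ a b, l a * MvPolynomial.aeval q (MvPolynomial.pderiv b f) =
    l b * MvPolynomial.aeval q (MvPolynomial.pderiv a f)

open MvPolynomial in
-- A point of the closure satisfies every equation valid on the generating pairs; incidence holds on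
-- those by Euler's identity.
theorem IsTangentAt.isConormal {f : MvPolynomial (Fin 3) ℂ} {n : ℕ} (hf : f.IsHomogeneous n)
    {q l : P2} (h : IsTangentAt f q l) : IsConormal f q.rep l.rep where
  eq_zero := by
    have := h (rename Sum.inl f) fun u w _ _ hu _ => by simpa [eval_rename] using hu
    simpa [eval_rename, aeval_eq_eval] using this
  incident := by
    have := h (∑ i, X (Sum.inr i) * X (Sum.inl i)) fun u w _ _ hu ⟨c, hc⟩ => by
      have he := congrArg (eval u) hf.sum_X_mul_pderiv
      simp only [map_sum, map_mul, eval_X, map_nsmul, hu, smul_zero] at he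
      simp only [map_sum, map_mul, eval_X, Sum.elim_inl, Sum.elim_inr, hc, Pi.smul_apply,
        gradient, smul_eq_mul]
      rw [← mul_zero c, ← he, Finset.mul_sum]
      exact Finset.sum_congr rfl fun i _ => by ring
    simpa [dotProduct] using this
  parallel a b := by
    have := h (X (Sum.inr a) * rename Sum.inl (pderiv b f) -
        X (Sum.inr b) * rename Sum.inl (pderiv a f)) fun u w _ _ hu ⟨c, hc⟩ => by
      simp [eval_rename, hc, gradient]
      ring
    simpa [eval_rename, aeval_eq_eval, sub_eq_zero] using this

theorem exists_isEpipolar {N₁ N₂ : Matrix (Fin 3) (Fin 4) ℂ} {T : P2 × P8 × P2}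
    (h : Realizes N₁ N₂ T) (h₁ : T.2.1.rep *ᵥ T.1.rep = 0) (h₂ : T.2.2.rep ᵥ* T.2.1.rep = 0) :
    ∃ R₁ R₂ C₁ C₂, IsEpipolar N₁ N₂ R₁ R₂ C₁ C₂ T.2.1.rep T.1.rep T.2.2.rep := by
  obtain ⟨⟨c, hc, hF⟩, C₁, C₂, ⟨hr₁, hC₁⟩, ⟨hr₂, hC₂⟩, ⟨a, ha, he₁⟩, ⟨b, hb, he₂⟩⟩ := h
  obtain ⟨R₁, hR₁⟩ := exists_right_inverse_of_rank hr₁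
  obtain ⟨R₂, hR₂⟩ := exists_right_inverse_of_rank hr₂
  refine ⟨R₁, R₂, b⁻¹ • C₁.rep, a⁻¹ • C₂.rep, hR₁, hR₂, ?_, ?_, ?_, ?_,
    T.1.rep_nonzero, T.2.2.rep_nonzero, T.2.1.rep_nonzero, h₁, h₂, fun x => ?_⟩
  · rw [Matrix.mulVec_smul, hC₁, smul_zero]
  · rw [Matrix.mulVec_smul, hC₂, smul_zero]
  · rw [Matrix.mulVec_smul, he₁, smul_smul, inv_mul_cancel₀ ha, one_smul]
  · rw [Matrix.mulVec_smul, he₂, smul_smul, inv_mul_cancel₀ hb, one_smul]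
  · have := fundamentalMatrix_incidence N₁ N₂ x
    rw [hF, Matrix.smul_mulVec, dotProduct_smul] at this
    exact (smul_eq_zero.1 this).resolve_left hc

variable {N₁ N₂ : Matrix (Fin 3) (Fin 4) ℂ} {R₁ R₂ : Matrix (Fin 4) (Fin 3) ℂ}
  {C₁ C₂ : Fin 4 → ℂ} {F : Matrix (Fin 3) (Fin 3) ℂ}

theorem IsEpipolar.exists_eq_of_mem_baseline {e₁ e₂ : Fin 3 → ℂ}
    (h : IsEpipolar N₁ N₂ R₁ R₂ C₁ C₂ F e₁ e₂) {P : P3} (hP : P ∈ baseline N₁ N₂) :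
    ∃ s t : ℂ, P.rep = s • C₁ + t • C₂ := by
  obtain ⟨u, hu, v, hv, huv⟩ := Submodule.mem_sup.1 hP
  obtain ⟨a, b, hab⟩ := h.exists_eq_of_mem_radical (epipolarForm_eq_zero₁ h.isAlt hu)
  obtain ⟨a', b', hab'⟩ := h.exists_eq_of_mem_radical (epipolarForm_eq_zero₂ F hv)
  refine ⟨a + a', b + b', ?_⟩
  rw [← huv, hab, hab']
  module

/-- Off the baseline each `qᵢ` differs from the epipole `eᵢ`, so the tangent through both is their
join. The epipolar vectors `q₂ᵀ F` and `F q₁` annihilate the same two points, hence are multiples of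
the tangents. -/
theorem IsEpipolar.exists_of_mem_spaceTangencyPoints {e₁ e₂ : P2}
    (h : IsEpipolar N₁ N₂ R₁ R₂ C₁ C₂ F e₁.rep e₂.rep) {f₁ f₂ : MvPolynomial (Fin 3) ℂ}
    {n₁ n₂ : ℕ} (hf₁ : f₁.IsHomogeneous n₁) (hf₂ : f₂.IsHomogeneous n₂) {P : P3}
    (hP : P ∈ spaceTangencyPoints f₁ f₂ N₁ N₂ e₁ e₂) (hPb : P ∉ baseline N₁ N₂) :
    ∃ (q₁ q₂ l₁ l₂ : Fin 3 → ℂ) (c₁ c₂ d₁ d₂ : ℂ), c₁ ≠ 0 ∧ c₂ ≠ 0 ∧ q₁ ≠ 0 ∧ q₂ ≠ 0 ∧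
      N₁ *ᵥ P.rep = c₁ • q₁ ∧ N₂ *ᵥ P.rep = c₂ • q₂ ∧ F *ᵥ q₁ = d₂ • l₂ ∧ q₂ ᵥ* F = d₁ • l₁ ∧
      IsConormal f₁ q₁ l₁ ∧ IsConormal f₂ q₂ l₂ := by
  obtain ⟨⟨q₁, ⟨l₁, hl₁, hle₁⟩, c₁, hc₁, hq₁⟩, q₂, ⟨l₂, hl₂, hle₂⟩, c₂, hc₂, hq₂⟩ := hP
  have hn₁ := hl₁.isConormal hf₁
  have hn₂ := hl₂.isConormal hf₂
  have hne₁ : ¬ ∃ c : ℂ, q₁.rep = c • e₁.rep := by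
    rintro ⟨c, hc⟩
    refine hPb (Submodule.mem_sup.2 ⟨P.rep - (c₁ * c) • C₂, ?_, (c₁ * c) • C₂, ?_, by simp⟩)
    · simp [Matrix.mulVec_sub, Matrix.mulVec_smul, h.epipole₁, hq₁, hc, smul_smul]
    · simp [h.centre₂]
  have hne₂ : ¬ ∃ c : ℂ, q₂.rep = c • e₂.rep := by
    rintro ⟨c, hc⟩
    refine hPb (Submodule.mem_sup.2 ⟨(c₂ * c) • C₁, ?_, P.rep - (c₂ * c) • C₁, ?_, by simp⟩)
    · simp [h.centre₁]
    · simp [Matrix.mulVec_sub, Matrix.mulVec_smul, h.epipole₂, hq₂, hc, smul_smul]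
  have hinc := h.incidence P.rep
  rw [hq₁, hq₂, Matrix.mulVec_smul, smul_dotProduct, dotProduct_smul] at hinc
  have hinc' := ((smul_eq_zero.1 hinc).resolve_left hc₂ |> smul_eq_zero.1).resolve_left hc₁
  obtain ⟨d₂, hd₂⟩ : ∃ c : ℂ, F *ᵥ q₁.rep = c • l₂.rep := by
    refine exists_eq_smul_of_orthogonal e₂.rep_nonzero hne₂ ?_ ?_ hle₂ hn₂.incident l₂.rep_nonzero
    · rw [dotProduct_comm, Matrix.dotProduct_mulVec, h.vecMul_eq_zero, zero_dotProduct]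
    · rw [dotProduct_comm, hinc']
  obtain ⟨d₁, hd₁⟩ : ∃ c : ℂ, q₂.rep ᵥ* F = c • l₁.rep := by
    refine exists_eq_smul_of_orthogonal e₁.rep_nonzero hne₁ ?_ ?_ hle₁ hn₁.incident l₁.rep_nonzero
    · rw [← Matrix.dotProduct_mulVec, h.mulVec_eq_zero, dotProduct_zero]
    · rw [← Matrix.dotProduct_mulVec, hinc']
  exact ⟨q₁.rep, q₂.rep, l₁.rep, l₂.rep, c₁, c₂, d₁, d₂, hc₁, hc₂, q₁.rep_nonzero,
    q₂.rep_nonzero, hq₁, hq₂, hd₂, hd₁, hn₁, hn₂⟩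

end Realization

/-! ### Limits over an ultrapower of the complex numbers -/

section Ultralimit

open Filter

/-- The homomorphism `π` presents `K` as the ultrapower of `ℂ` along the hyperfilter on `ℕ`. -/
structure IsUltralimit {K : Type*} [Field K] [Algebra ℂ K] (π : (ℕ → ℂ) →ₐ[ℂ] K) : Prop where
  surjective : Function.Surjective π
  eq_zero_iff : ∀ x, π x = 0 ↔ ∀ᶠ n in hyperfilter ℕ, x n = 0

theorem exists_isUltralimit : ∃ (K : Type) (_ : Field K) (_ : Algebra ℂ K)
    (π : (ℕ → ℂ) →ₐ[ℂ] K), IsUltralimit π := by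
  let c : (ℕ → ℂ) →+* Germ (hyperfilter ℕ : Filter ℕ) ℂ := Germ.coeRingHom _
  let : Algebra ℂ (Germ (hyperfilter ℕ : Filter ℕ) ℂ) :=
    (c.comp (algebraMap ℂ (ℕ → ℂ))).toAlgebra
  refine ⟨Germ (hyperfilter ℕ : Filter ℕ) ℂ, inferInstance, this,
    { c with commutes' := fun _ => rfl }, ?_, ?_⟩
  · intro x
    induction x using Germ.inductionOn with
    | _ f => exact ⟨f, rfl⟩
  · intro x
    exact Germ.coe_eq (f := x) (g := 0)

variable {K : Type*} [Field K] [Algebra ℂ K] (π : (ℕ → ℂ) →ₐ[ℂ] K)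

/-- The limit of a sequence of vectors. -/
def vecLim {ι : Type*} (v : ℕ → ι → ℂ) : ι → K := fun i => π fun n => v n i

/-- The limit of a sequence of matrices. -/
def matLim {ι κ : Type*} (M : ℕ → Matrix ι κ ℂ) : Matrix ι κ K :=
  Matrix.of fun i j => π fun n => M n i j

theorem dotProduct_vecLim {ι : Type*} [Fintype ι] (v w : ℕ → ι → ℂ) :
    vecLim π v ⬝ᵥ vecLim π w = π fun n => v n ⬝ᵥ w n := by
  simp only [dotProduct, vecLim, ← map_mul, ← map_sum]
  congr 1
  ext n
  simp

theorem matLim_mulVec {ι κ : Type*} [Fintype κ] (M : ℕ → Matrix ι κ ℂ) (v : ℕ → κ → ℂ) :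
    matLim π M *ᵥ vecLim π v = vecLim π fun n => M n *ᵥ v n :=
  funext fun i => dotProduct_vecLim π (fun n => M n i) v

theorem vecMul_matLim {ι κ : Type*} [Fintype ι] (v : ℕ → ι → ℂ) (M : ℕ → Matrix ι κ ℂ) :
    vecLim π v ᵥ* matLim π M = vecLim π fun n => v n ᵥ* M n :=
  funext fun j => dotProduct_vecLim π v fun n i => M n i j

theorem matLim_mul {ι κ μ : Type*} [Fintype κ] (M : ℕ → Matrix ι κ ℂ) (N : ℕ → Matrix κ μ ℂ) :
    matLim π M * matLim π N = matLim π fun n => M n * N n :=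
  Matrix.ext fun i j => dotProduct_vecLim π (fun n => M n i) fun n k => N n k j

theorem smul_vecLim {ι : Type*} (c : ℕ → ℂ) (v : ℕ → ι → ℂ) :
    π c • vecLim π v = vecLim π fun n => c n • v n :=
  funext fun i => (map_mul π c fun n => v n i).symm

theorem vecLim_add {ι : Type*} (v w : ℕ → ι → ℂ) :
    vecLim π v + vecLim π w = vecLim π fun n => v n + w n :=
  funext fun i => (map_add π (fun n => v n i) fun n => w n i).symm

theorem aeval_vecLim {ι : Type*} (v : ℕ → ι → ℂ) (f : MvPolynomial ι ℂ) :
    MvPolynomial.aeval (vecLim π v) f = π fun n => MvPolynomial.aeval (v n) f := by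
  have h : (fun n => MvPolynomial.aeval (v n) f) = MvPolynomial.aeval (fun i n => v n i) f := by
    funext n
    have := MvPolynomial.comp_aeval (fun i n => v n i) (Pi.evalAlgHom ℂ (fun _ : ℕ => ℂ) n)
    exact (AlgHom.congr_fun this f).symm
  rw [h, ← AlgHom.comp_apply, MvPolynomial.comp_aeval]
  rfl

namespace IsUltralimit

variable {π}

theorem congr (hπ : IsUltralimit π) {x y : ℕ → ℂ} (h : ∀ᶠ n in hyperfilter ℕ, x n = y n) : π x = π y := by
  rw [← sub_eq_zero, ← map_sub, hπ.eq_zero_iff]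
  filter_upwards [h] with n hn
  rw [Pi.sub_apply, hn, sub_self]

theorem ne_zero (hπ : IsUltralimit π) {x : ℕ → ℂ} (h : ∀ᶠ n in hyperfilter ℕ, x n ≠ 0) : π x ≠ 0 := by
  rw [Ne, hπ.eq_zero_iff]
  intro h0
  obtain ⟨n, h1, h2⟩ := (h.and h0).exists
  exact h1 h2

theorem vecLim_congr (hπ : IsUltralimit π) {ι : Type*} {v w : ℕ → ι → ℂ} (h : ∀ᶠ n in hyperfilter ℕ, v n = w n) :
    vecLim π v = vecLim π w :=
  funext fun i => hπ.congr (h.mono fun _ hn => congrFun hn i)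

theorem vecLim_ne_zero (hπ : IsUltralimit π) {ι : Type*} [Finite ι] {v : ℕ → ι → ℂ}
    (h : ∀ᶠ n in hyperfilter ℕ, v n ≠ 0) : vecLim π v ≠ 0 := by
  intro h0
  have : ∀ᶠ n in hyperfilter ℕ, ∀ i, v n i = 0 :=
    eventually_all.2 fun i => (hπ.eq_zero_iff _).1 (congrFun h0 i)
  obtain ⟨n, h1, h2⟩ := (h.and this).exists
  exact h1 (funext h2)

theorem matLim_ne_zero (hπ : IsUltralimit π) {ι κ : Type*} [Finite ι] [Finite κ] {M : ℕ → Matrix ι κ ℂ}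
    (h : ∀ᶠ n in hyperfilter ℕ, M n ≠ 0) : matLim π M ≠ 0 := by
  intro h0
  have : ∀ᶠ n in hyperfilter ℕ, ∀ i j, M n i j = 0 :=
    eventually_all.2 fun i => eventually_all.2 fun j =>
      (hπ.eq_zero_iff _).1 (congrFun (congrFun h0 i) j)
  obtain ⟨n, h1, h2⟩ := (h.and this).exists
  exact h1 (Matrix.ext h2)

theorem exists_vecLim_eq (hπ : IsUltralimit π) {ι : Type*} (x : ι → K) : ∃ v, vecLim π v = x := by
  choose y hy using fun i => hπ.surjective (x i)
  exact ⟨fun n i => y i n, funext hy⟩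

theorem exists_matLim_eq (hπ : IsUltralimit π) {ι κ : Type*} (x : Matrix ι κ K) : ∃ M, matLim π M = x := by
  choose y hy using fun i j => hπ.surjective (x i j)
  exact ⟨fun n => Matrix.of fun i j => y i j n, Matrix.ext hy⟩

theorem isConormal (hπ : IsUltralimit π) {f : MvPolynomial (Fin 3) ℂ} {q l : ℕ → Fin 3 → ℂ}
    (h : ∀ᶠ n in hyperfilter ℕ, IsConormal f (q n) (l n)) :
    IsConormal f (vecLim π q) (vecLim π l) where
  eq_zero := by
    rw [aeval_vecLim, hπ.eq_zero_iff]
    exact h.mono fun n hn => hn.eq_zero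
  incident := by
    rw [dotProduct_vecLim, hπ.eq_zero_iff]
    exact h.mono fun n hn => hn.incident
  parallel a b := by
    simp only [aeval_vecLim, vecLim]
    rw [← map_mul π, ← map_mul π]
    exact hπ.congr (h.mono fun n hn => hn.parallel a b)

/-- Every condition is a polynomial identity or the nonvanishing of a vector, so it passes to the
limit. Right inverses put the rank condition in this form. -/
theorem isEpipolar (hπ : IsUltralimit π) {N₁ N₂ : ℕ → Matrix (Fin 3) (Fin 4) ℂ} {R₁ R₂ : ℕ → Matrix (Fin 4) (Fin 3) ℂ}
    {C₁ C₂ : ℕ → Fin 4 → ℂ} {F : ℕ → Matrix (Fin 3) (Fin 3) ℂ} {e₁ e₂ : ℕ → Fin 3 → ℂ}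
    (h : ∀ n, IsEpipolar (N₁ n) (N₂ n) (R₁ n) (R₂ n) (C₁ n) (C₂ n) (F n) (e₁ n) (e₂ n)) :
    IsEpipolar (matLim π N₁) (matLim π N₂) (matLim π R₁) (matLim π R₂) (vecLim π C₁)
      (vecLim π C₂) (matLim π F) (vecLim π e₁) (vecLim π e₂) := by
  have hone : matLim π (fun _ => (1 : Matrix (Fin 3) (Fin 3) ℂ)) = 1 := by
    ext i j
    by_cases hij : i = j
    · subst hij
      simp only [matLim, Matrix.of_apply, Matrix.one_apply_eq]
      exact map_one π
    · simp only [matLim, Matrix.of_apply, Matrix.one_apply_ne hij]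
      exact map_zero π
  have hzero : vecLim π (fun _ => (0 : Fin 3 → ℂ)) = 0 := funext fun i => map_zero π
  refine ⟨?_, ?_, ?_, ?_, ?_, ?_, ?_, ?_, ?_, ?_, ?_, fun x => ?_⟩
  · simp only [matLim_mul, (h _).mul_right₁, hone]
  · simp only [matLim_mul, (h _).mul_right₂, hone]
  · simp only [matLim_mulVec, (h _).centre₁, hzero]
  · simp only [matLim_mulVec, (h _).centre₂, hzero]
  · simp only [matLim_mulVec, (h _).epipole₁]
  · simp only [matLim_mulVec, (h _).epipole₂]
  · exact hπ.vecLim_ne_zero (.of_forall fun n => (h n).ne_zero₁)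
  · exact hπ.vecLim_ne_zero (.of_forall fun n => (h n).ne_zero₂)
  · exact hπ.matLim_ne_zero (.of_forall fun n => (h n).ne_zero)
  · simp only [matLim_mulVec, (h _).mulVec_eq_zero, hzero]
  · simp only [vecMul_matLim, (h _).vecMul_eq_zero, hzero]
  · obtain ⟨v, rfl⟩ := hπ.exists_vecLim_eq x
    simp only [matLim_mulVec, dotProduct_vecLim, (h _).incidence]
    exact map_zero π

end IsUltralimit

end Ultralimit

/-! ### Finiteness and discreteness -/

section Finiteness

open Filter

theorem eq_of_rep_eq_smul {E : Type*} [AddCommGroup E] [Module ℂ E] {v w : ℙ ℂ E} {a : ℂ}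
    (h : v.rep = a • w.rep) : v = w := by
  rw [← v.mk_rep, ← w.mk_rep, Projectivization.mk_eq_mk_iff']
  exact ⟨a, h.symm⟩

/-- A sequence of distinct epipolar geometries has a limit over the ultrapower whose normalized
fundamental matrix is moved by some derivation. -/
theorem exists_derivation_fundamental_ne_zero {K : Type*} [Field K] [Algebra ℂ K]
    {π : (ℕ → ℂ) →ₐ[ℂ] K} (hπ : IsUltralimit π) {N₁ N₂ : ℕ → Matrix (Fin 3) (Fin 4) ℂ}
    {R₁ R₂ : ℕ → Matrix (Fin 4) (Fin 3) ℂ} {C₁ C₂ : ℕ → Fin 4 → ℂ} {T : ℕ → P2 × P8 × P2}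
    (hT : Function.Injective T)
    (h : ∀ n, IsEpipolar (N₁ n) (N₂ n) (R₁ n) (R₂ n) (C₁ n) (C₂ n) (T n).2.1.rep (T n).1.rep
      (T n).2.2.rep) :
    ∃ (c : K) (i j : Fin 3), c ≠ 0 ∧ (c • matLim π fun n => (T n).2.1.rep) i j = 1 ∧
      ∃ (D : Derivation ℂ K K) (a b : Fin 3),
        D ((c • matLim π fun n => (T n).2.1.rep) a b) ≠ 0 := by
  set F := matLim π fun n => (T n).2.1.rep with hF
  have hF0 : F ≠ 0 := hπ.matLim_ne_zero (.of_forall fun n => (h n).ne_zero)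
  obtain ⟨i, j, hij⟩ : ∃ i j, F i j ≠ 0 := by
    by_contra! h0
    exact hF0 (Matrix.ext h0)
  refine ⟨(F i j)⁻¹, i, j, inv_ne_zero hij, by simp [hij], ?_⟩
  by_contra! hD
  -- An element killed by all derivations is a complex number, so the normalized limit would be a
  -- constant matrix `c`.
  choose c hc using fun a b => exists_algebraMap_eq_of_forall_derivation fun D => hD D a b
  have hev : ∀ᶠ n in hyperfilter ℕ, ∀ a b,
      (T n).2.1.rep a b = (T n).2.1.rep i j * c a b := by
    refine eventually_all.2 fun a => eventually_all.2 fun b => ?_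
    have h1 : π ((fun n => (T n).2.1.rep a b) -
        (fun n => (T n).2.1.rep i j) * algebraMap ℂ (ℕ → ℂ) (c a b)) = 0 := by
      rw [map_sub, map_mul, AlgHom.commutes, hc, Matrix.smul_apply, smul_eq_mul]
      change F a b - F i j * _ = 0
      rw [mul_inv_cancel_left₀ hij, sub_self]
    filter_upwards [(hπ.eq_zero_iff _).1 h1] with n hn
    exact sub_eq_zero.1 hn
  -- Sets of the hyperfilter are infinite, so two different indices give the same projective matrix.
  have hinf : {n | ∀ a b, (T n).2.1.rep a b = (T n).2.1.rep i j * c a b}.Infinite :=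
    fun hfin => notMem_hyperfilter_of_finite hfin hev
  obtain ⟨n, hn, m, hm, hnm⟩ := hinf.nontrivial
  have hm0 : (T m).2.1.rep i j ≠ 0 := by
    intro h0
    refine (h m).ne_zero (Matrix.ext fun a b => ?_)
    rw [hm a b, h0, zero_mul, Matrix.zero_apply]
  have hFeq : (T n).2.1 = (T m).2.1 := by
    refine eq_of_rep_eq_smul (a := (T n).2.1.rep i j / (T m).2.1.rep i j)
      (Matrix.ext fun a b => ?_)
    rw [Matrix.smul_apply, smul_eq_mul, hn a b, hm a b]
    field_simp
  -- The kernels of `F` are lines, so the matrix determines both epipoles and the two triples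
  -- coincide.
  obtain ⟨s, hs⟩ := (h m).exists_eq_smul_of_mulVec (hFeq ▸ (h n).mulVec_eq_zero)
  obtain ⟨t, ht⟩ := (h m).exists_eq_smul_of_vecMul (hFeq ▸ (h n).vecMul_eq_zero)
  exact hnm (hT (Prod.ext (eq_of_rep_eq_smul hs) (Prod.ext hFeq (eq_of_rep_eq_smul ht))))

/-- Only finitely many epipolar geometries have a realization for which the baseline and the space
tangency points do not lie on a quadric. -/
theorem finite_of_not_liesOnQuadric {f₁ f₂ : MvPolynomial (Fin 3) ℂ} {n₁ n₂ : ℕ}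
    (hf₁ : Irreducible f₁) (hf₂ : Irreducible f₂) (hn₁ : f₁.IsHomogeneous n₁)
    (hn₂ : f₂.IsHomogeneous n₂) {S : Set (P2 × P8 × P2)}
    (hS : ∀ T ∈ S, T.2.1.rep *ᵥ T.1.rep = 0 ∧ T.2.2.rep ᵥ* T.2.1.rep = 0)
    (hquad : ∀ T ∈ S, ∃ N₁ N₂ : Matrix (Fin 3) (Fin 4) ℂ, Realizes N₁ N₂ T ∧
      ¬ LiesOnQuadric (baseline N₁ N₂ ∪ spaceTangencyPoints f₁ f₂ N₁ N₂ T.1 T.2.2)) :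
    S.Finite := by
  by_contra hinf
  obtain ⟨K, _, _, π, hπ⟩ := exists_isUltralimit
  let T : ℕ → P2 × P8 × P2 := fun n => (Set.Infinite.natEmbedding S hinf n).1
  have hTS : ∀ n, T n ∈ S := fun n => (Set.Infinite.natEmbedding S hinf n).2
  have hT : Function.Injective T :=
    Subtype.val_injective.comp (Set.Infinite.natEmbedding S hinf).injective
  choose N₁ N₂ hreal hnot using fun n => hquad (T n) (hTS n)
  choose R₁ R₂ C₁ C₂ hepi using fun n =>
    exists_isEpipolar (hreal n) (hS _ (hTS n)).1 (hS _ (hTS n)).2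
  obtain ⟨c, i, j, hc, hij, D, a, b, hab⟩ := exists_derivation_fundamental_ne_zero hπ hT hepi
  have hlim := hπ.isEpipolar hepi
  have hlim' := hlim.smul hc
  -- The derivation acts only on `K`; choosing representatives `G n` of `DF` brings the form back to
  -- `ℂ`.
  obtain ⟨G, hG⟩ := hπ.exists_matLim_eq ((c • matLim π fun n => (T n).2.1.rep).map D)
  have hB : ∀ v : ℕ → Fin 4 → ℂ,
      (matLim π N₂ *ᵥ vecLim π v) ⬝ᵥ ((c • matLim π fun n => (T n).2.1.rep).map D *ᵥ
        (matLim π N₁ *ᵥ vecLim π v)) = π fun n => (N₂ n *ᵥ v n) ⬝ᵥ (G n *ᵥ (N₁ n *ᵥ v n)) := by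
    intro v
    rw [← hG, matLim_mulVec, matLim_mulVec, matLim_mulVec, dotProduct_vecLim]
  let B : ℕ → QuadraticForm ℂ (Fin 4 → ℂ) := fun n =>
    (epipolarForm (N₁ n) (N₂ n) (G n)).toQuadraticMap
  have hBapply : ∀ n x, B n x = (N₂ n *ᵥ x) ⬝ᵥ (G n *ᵥ (N₁ n *ᵥ x)) := fun n x => by
    rw [← epipolarForm_apply]; rfl
  have hBne : ∀ᶠ n in hyperfilter ℕ, B n ≠ 0 := by
    obtain ⟨x, hx⟩ := hlim'.exists_quadratic_ne_zero D hij hab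
    obtain ⟨v, rfl⟩ := hπ.exists_vecLim_eq x
    rw [hB, Ne, hπ.eq_zero_iff, ← Ultrafilter.eventually_not] at hx
    filter_upwards [hx] with n hn h0
    rw [← hBapply, h0] at hn
    exact hn rfl
  obtain ⟨P, hP⟩ := skolem.1 (hBne.mono fun n hn => by
    have : ∃ P, P ∈ baseline (N₁ n) (N₂ n) ∪
        spaceTangencyPoints f₁ f₂ (N₁ n) (N₂ n) (T n).1 (T n).2.2 ∧ B n P.rep ≠ 0 := by
      by_contra! h0
      exact hnot n ⟨B n, hn, h0⟩
    exact this)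
  let x : ℕ → Fin 4 → ℂ := fun n => (P n).rep
  have hne : (matLim π N₂ *ᵥ vecLim π x) ⬝ᵥ ((c • matLim π fun n => (T n).2.1.rep).map D *ᵥ
      (matLim π N₁ *ᵥ vecLim π x)) ≠ 0 := by
    rw [hB]
    refine hπ.ne_zero (hP.mono fun n hn => ?_)
    rw [← hBapply]
    exact hn.2
  apply hne
  -- An ultrafilter decides: almost all points lie on the baseline or almost all lie off it.
  rcases (Ultrafilter.eventually_or (p := fun n => P n ∈ baseline (N₁ n) (N₂ n))
    (q := fun n => P n ∉ baseline (N₁ n) (N₂ n))).1 (.of_forall fun n => em _) with hb | hb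
  · obtain ⟨s, hs⟩ := skolem.1 (hb.mono fun n hn => (hepi n).exists_eq_of_mem_baseline hn)
    obtain ⟨t, ht⟩ := skolem.1 hs
    have hx : vecLim π x = π s • vecLim π C₁ + π t • vecLim π C₂ := by
      rw [smul_vecLim, smul_vecLim, vecLim_add]
      exact hπ.vecLim_congr ht
    rw [hx]
    exact hlim'.quadratic_baseline D _ _
  · have hdata := (hP.and hb).mono fun n hn =>
      (hepi n).exists_of_mem_spaceTangencyPoints hn₁ hn₂ (hn.1.1.resolve_left hn.2) hn.2
    obtain ⟨q₁, hdata⟩ := skolem.1 hdata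
    obtain ⟨q₂, hdata⟩ := skolem.1 hdata
    obtain ⟨l₁, hdata⟩ := skolem.1 hdata
    obtain ⟨l₂, hdata⟩ := skolem.1 hdata
    obtain ⟨c₁, hdata⟩ := skolem.1 hdata
    obtain ⟨c₂, hdata⟩ := skolem.1 hdata
    obtain ⟨d₁, hdata⟩ := skolem.1 hdata
    obtain ⟨d₂, hdata⟩ := skolem.1 hdata
    simp only [eventually_and] at hdata
    obtain ⟨hc₁, hc₂, hq₁, hq₂, hN₁, hN₂, hF₂, hF₁, hcon₁, hcon₂⟩ := hdata
    have hcon₁ := hπ.isConormal hcon₁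
    have hcon₂ := hπ.isConormal hcon₂
    refine hlim'.quadratic_tangency D (q₁ := vecLim π q₁) (q₂ := vecLim π q₂)
      (l₁ := vecLim π l₁) (l₂ := vecLim π l₂) (c₁ := π c₁) (c₂ := π c₂) (d₁ := c * π d₁)
      (d₂ := c * π d₂) (hπ.ne_zero hc₁) (hπ.ne_zero hc₂) ?_ ?_ ?_ ?_ ?_ ?_
    · rw [matLim_mulVec, smul_vecLim]
      exact hπ.vecLim_congr hN₁
    · rw [matLim_mulVec, smul_vecLim]
      exact hπ.vecLim_congr hN₂
    · rw [Matrix.smul_mulVec, matLim_mulVec, mul_smul, smul_vecLim, hπ.vecLim_congr hF₂]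
    · rw [Matrix.vecMul_smul, vecMul_matLim, mul_smul, smul_vecLim, hπ.vecLim_congr hF₁]
    · exact dotProduct_derivation_eq_zero hf₁ hn₁ (hπ.vecLim_ne_zero hq₁) hcon₁.eq_zero
        hcon₁.incident hcon₁.parallel D
    · exact dotProduct_derivation_eq_zero hf₂ hn₂ (hπ.vecLim_ne_zero hq₂) hcon₂.eq_zero
        hcon₂.incident hcon₂.parallel D

/-- The fibre over a point is a line without the origin, closed among nonzero vectors. In a T1 space
finite sets are discrete. -/
instance projectivization_t1Space (E : Type*) [AddCommGroup E] [Module ℂ E] [TopologicalSpace E]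
    [IsTopologicalAddGroup E] [ContinuousSMul ℂ E] [T2Space E] : T1Space (ℙ ℂ E) where
  t1 x := by
    refine isClosed_coinduced.2 ?_
    have : (fun v : { v : E // v ≠ 0 } => Projectivization.mk ℂ v.1 v.2) ⁻¹' {x} =
        Subtype.val ⁻¹' (Submodule.span ℂ {x.rep} : Set E) := by
      ext v
      rw [Set.mem_preimage, Set.mem_singleton_iff, Set.mem_preimage, SetLike.mem_coe,
        Submodule.mem_span_singleton]
      conv_lhs => rw [← x.mk_rep]
      exact Projectivization.mk_eq_mk_iff' ..
    rw [this]
    exact (Submodule.closed_of_finiteDimensional _).preimage continuous_subtype_val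

end Finiteness

end TwoViews

theorem mainTheorem8 (X : Set TwoViews.P3) (hX : TwoViews.IsSmoothIrreducibleCurve X)
    (hplanar : ¬ TwoViews.IsPlanar X) :
    TwoViews.ForGenericCentres fun O₁ O₂ =>
      ∀ M₁ M₂ : Matrix (Fin 3) (Fin 4) ℂ,
        TwoViews.IsProjectionFrom M₁ O₁ → TwoViews.IsProjectionFrom M₂ O₂ →
      ∀ f₁ f₂ φ₁ φ₂ : MvPolynomial (Fin 3) ℂ,
        TwoViews.IsEquationOf f₁ (TwoViews.projected M₁ X) →
        TwoViews.IsEquationOf f₂ (TwoViews.projected M₂ X) →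
        TwoViews.IsEquationOf φ₁ (TwoViews.dualCurve f₁) →
        TwoViews.IsEquationOf φ₂ (TwoViews.dualCurve f₂) →
        (∀ T ∈ TwoViews.kruppaVariety φ₁ φ₂,
          ∃ N₁ N₂ : Matrix (Fin 3) (Fin 4) ℂ, TwoViews.Realizes N₁ N₂ T ∧
            ¬ TwoViews.LiesOnQuadric
              (TwoViews.baseline N₁ N₂ ∪
                TwoViews.spaceTangencyPoints f₁ f₂ N₁ N₂ T.1 T.2.2)) →
        IsDiscrete (TwoViews.kruppaVariety φ₁ φ₂) ∧
          (TwoViews.kruppaVariety φ₁ φ₂).Finite := by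
  -- No pair of centres has to be excluded, so the constant polynomial `1` serves.
  refine ⟨1, one_ne_zero, ?_⟩
  intro _ _ _ _ _ M₁ M₂ _ _ f₁ f₂ φ₁ φ₂ hf₁ hf₂ _ _ hquad
  obtain ⟨n₁, hn₁⟩ := hf₁.2.1
  obtain ⟨n₂, hn₂⟩ := hf₂.2.1
  have hfin := TwoViews.finite_of_not_liesOnQuadric hf₁.1 hf₂.1 hn₁ hn₂
    (fun T hT => hT.2) hquad
  exact ⟨hfin.isDiscrete, hfin⟩
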